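/- Let $X$ be a regular $T_1$ topological space. Let $\mathcal{K}(X)$ be the set of all non-empty compact subsets of $X$, $\mathcal{F}(X)$ the set of all non-empty finite subsets of $X$, and $\mathcal{F}_2(X)$ the set of all non-empty subsets of $X$ with at most two points. Each of them carries the Vietoris topology $\tau_V$, i.e. the topology generated by the sets $\{H : H\subset U_1\cup\dots\cup U_k,\ H\cap U_j\neq\emptyset \text{ for } 1\le j\le k\}$, where $k\ge 1$ and $U_1,\dots,U_k$ are open subsets of $X$. A space $Y$ is called a $D_0$-space if every compact subset $K$ of $Y$ has a countable local base, i.e. there is a countable family $\mathcal{B}$ of open sets containing $K$ such that every open set containing $K$ contains a member of $\mathcal{B}$. A continuous map $f:M\to Y$ is called compact-covering if every compact subset of $Y$ is the image under $f$ of some compact subset of $M$. The following statements are equivalent: 1. $(\mathcal{K}(X),\tau_V)$ is the image of a metric space under an open compact-covering map; 2. $(\mathcal{K}(X),\tau_V)$ is a $D_0$-space; 3. $(\mathcal{F}(X),\tau_V)$ is a $D_0$-space; 4. $(\mathcal{F}_2(X),\tau_V)$ is a $D_0$-space; 5. $X$ is a $D_0$-space and every compact subset of $X$ is metrizable. -/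

import Mathlib

open Set Topology TopologicalSpace

universe u

namespace Hyperspace

/-- A `D₀`-space: every compact subset `K` has a countable local base, that is, a countable family
of open sets containing `K` such that every open set containing `K` contains a member of it. -/
def IsD0Space (Y : Type u) [TopologicalSpace Y] : Prop :=
  ∀ K : Set Y, IsCompact K →
    ∃ B : Set (Set Y), B.Countable ∧ (∀ V ∈ B, IsOpen V ∧ K ⊆ V) ∧
      ∀ U : Set Y, IsOpen U → K ⊆ U → ∃ V ∈ B, V ⊆ U

/-- A compact-covering map: a continuous map such that every compact subset of the codomain is the
image of some compact subset of the domain. -/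
def IsCompactCovering {M Y : Type u} [TopologicalSpace M] [TopologicalSpace Y] (f : M → Y) :
    Prop :=
  Continuous f ∧ ∀ K : Set Y, IsCompact K → ∃ C : Set M, IsCompact C ∧ f '' C = K

/-- `Y` is the image of a metric space under an open compact-covering map. -/
def IsOpenCompactCoveringImageOfMetric (Y : Type u) [TopologicalSpace Y] : Prop :=
  ∃ (M : Type u) (_ : MetricSpace M) (f : M → Y),
    IsCompactCovering f ∧ IsOpenMap f ∧ Function.Surjective f

/-- `𝓚(X)`: the nonempty compact subsets of `X`. Mathlib's topology on it is the Vietoris topology,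
generated by `{K | K ⊆ U}` and `{K | (K ∩ U).Nonempty}` for `U` open in `X`. -/
abbrev HyperK (X : Type u) [TopologicalSpace X] : Type u := NonemptyCompacts X

/-- `𝓕(X)`: the nonempty finite subsets of `X`, as a subspace of `𝓚(X)`. -/
abbrev HyperF (X : Type u) [TopologicalSpace X] : Type u :=
  {A : HyperK X // (A : Set X).Finite}

/-- `𝓕ₙ(X)`: the nonempty subsets of `X` with at most `n` points, as a subspace of `𝓚(X)`. -/
abbrev HyperFn (n : ℕ) (X : Type u) [TopologicalSpace X] : Type u :=
  {A : HyperK X // (A : Set X).encard ≤ n}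

end Hyperspace

open Filter

namespace Hyperspace

variable {X Y : Type u} [TopologicalSpace X] [TopologicalSpace Y]

/-! Thickenings of a compact `C` in a metric space form a countable base around it, and an open map
carries this to `f '' C`; so 1 gives 2. The property passes to subspaces, giving 3 and 4, and to
`X`, embedded by `x ↦ {x}`. For compact `K ⊆ X`, a countable base at the singletons of `K` pulls
back along `(x, y) ↦ {x, y}` to a countable base of the uniformity of `K`, so `K` is metrizable. For
5 to 1, a compact family of compacta has compact, hence metrizable, union. That union has a
countable outer base in `X`, which induces one for the family. The metric space is then a Ponomarev
space: sequences of open sets enumerating a neighborhood base of a point, mapped to that point. -/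

theorem IsD0Space.of_isInducing {f : X → Y} (hf : IsInducing f) (h : IsD0Space Y) :
    IsD0Space X := by
  intro K hK
  obtain ⟨B, hB, hBK, hBU⟩ := h (f '' K) (hK.image hf.continuous)
  refine ⟨(f ⁻¹' ·) '' B, hB.image _, ?_, ?_⟩
  · rintro _ ⟨V, hV, rfl⟩
    exact ⟨(hBK V hV).1.preimage hf.continuous, image_subset_iff.mp (hBK V hV).2⟩
  · intro U hU hKU
    obtain ⟨U, hU', rfl⟩ := hf.isOpen_iff.mp hU
    obtain ⟨V, hV, hVU⟩ := hBU U hU' (image_subset_iff.mpr hKU)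
    exact ⟨_, mem_image_of_mem _ hV, preimage_mono hVU⟩

theorem IsOpenCompactCoveringImageOfMetric.isD0Space (h : IsOpenCompactCoveringImageOfMetric Y) :
    IsD0Space Y := by
  obtain ⟨M, _, f, ⟨hf, hcov⟩, hopen, -⟩ := h
  intro K hK
  obtain ⟨C, hC, rfl⟩ := hcov K hK
  refine ⟨range fun n : ℕ => f '' Metric.thickening (1 / (n + 1 : ℝ)) C, countable_range _, ?_, ?_⟩
  · rintro _ ⟨n, rfl⟩
    exact ⟨hopen _ Metric.isOpen_thickening,
      image_mono (Metric.self_subset_thickening (by positivity) C)⟩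
  · intro U hU hCU
    obtain ⟨δ, hδ, hδU⟩ :=
      hC.exists_thickening_subset_open (hU.preimage hf) (image_subset_iff.mp hCU)
    obtain ⟨n, hn⟩ := exists_nat_one_div_lt hδ
    exact ⟨_, mem_range_self n,
      image_subset_iff.mpr ((Metric.thickening_mono hn.le C).trans hδU)⟩

/-- A countable family of open sets containing a neighborhood base in `Y` at each point of `K`. -/
def HasCountableOuterBase (K : Set Y) : Prop :=
  ∃ P : Set (Opens Y), P.Countable ∧
    ∀ x ∈ K, ∀ U : Set Y, IsOpen U → x ∈ U → ∃ V ∈ P, x ∈ V ∧ (V : Set Y) ⊆ U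

theorem exists_finite_refining_cover {K L : Set Y} {P : Set (Opens Y)}
    (hP : ∀ x ∈ K, ∀ U : Set Y, IsOpen U → x ∈ U → ∃ V ∈ P, x ∈ V ∧ (V : Set Y) ⊆ U)
    (hL : IsCompact L) (hLK : L ⊆ K) (O : Y → Set Y) (hO : ∀ x ∈ L, IsOpen (O x) ∧ x ∈ O x) :
    ∃ c ⊆ P, c.Finite ∧ (∀ x ∈ L, ∃ V ∈ c, x ∈ V) ∧
      ∀ V ∈ c, ∃ x ∈ L, x ∈ V ∧ (V : Set Y) ⊆ O x := by
  choose! g hgP hxg hgO using fun x (hx : x ∈ L) => hP x (hLK hx) (O x) (hO x hx).1 (hO x hx).2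
  obtain ⟨t, htL, ht⟩ := hL.elim_nhds_subcover (fun x => (g x : Set Y))
    fun x hx => (g x).isOpen.mem_nhds (hxg x hx)
  refine ⟨g '' t, ?_, t.finite_toSet.image g, fun x hx => ?_, ?_⟩
  · rintro _ ⟨x, hx, rfl⟩
    exact hgP x (htL x hx)
  · obtain ⟨y, hy, hxy⟩ := mem_iUnion₂.mp (ht hx)
    exact ⟨g y, mem_image_of_mem g hy, hxy⟩
  · rintro _ ⟨x, hx, rfl⟩
    exact ⟨x, htL x hx, hxg x (htL x hx), hgO x (htL x hx)⟩

/-- Take a countable basis of `K` and collect countable local bases in `X` of the compact closures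
of its members. By regularity these closures shrink into any given neighborhood of a point. -/
theorem IsD0Space.hasCountableOuterBase [T2Space X] [RegularSpace X] (h : IsD0Space X)
    {K : Set X} (hK : IsCompact K) [MetrizableSpace K] : HasCountableOuterBase K := by
  have : CompactSpace K := isCompact_iff_compactSpace.mp hK
  let := metrizableSpaceMetric K
  have hsub (D : Set K) : closure ((↑) '' D : Set X) ⊆ K :=
    closure_minimal (Subtype.coe_image_subset K D) hK.isClosed
  choose B hBc hB hBU using fun D : Set K =>
    h (closure ((↑) '' D : Set X)) (hK.of_isClosed_subset isClosed_closure (hsub D))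
  refine ⟨⋃ D ∈ countableBasis K, {V : Opens X | (V : Set X) ∈ B D},
    (countable_countableBasis K).biUnion fun D _ =>
      (hBc D).preimage (SetLike.coe_injective (A := Opens X)), ?_⟩
  intro x hx U hU hxU
  obtain ⟨W, hWx, hWc, hWU⟩ := exists_mem_nhds_isClosed_subset (hU.mem_nhds hxU)
  obtain ⟨D, hD, hxD, hDW⟩ := (isBasis_countableBasis K).mem_nhds_iff.mp
    (continuous_subtype_val.continuousAt (x := (⟨x, hx⟩ : K)) hWx)
  obtain ⟨V, hV, hVU⟩ := hBU D U hU
    ((closure_minimal (image_subset_iff.mpr hDW) hWc).trans hWU)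
  exact ⟨⟨V, (hB D V hV).1⟩, mem_biUnion hD hV,
    (hB D V hV).2 (subset_closure ⟨_, hxD, rfl⟩), hVU⟩

theorem HasCountableOuterBase.nonemptyCompacts {A : Set (NonemptyCompacts X)}
    (h : HasCountableOuterBase (⋃ K ∈ A, (K : Set X))) : HasCountableOuterBase A := by
  obtain ⟨P, hPc, hP⟩ := h
  let vset (u : Set (Opens X)) : Set (NonemptyCompacts X) :=
    {K | (∀ x ∈ K, ∃ V ∈ u, x ∈ V) ∧ ∀ V ∈ u, ((K : Set X) ∩ V).Nonempty}
  have hvset (u : Set (Opens X)) (hu : u.Finite) : IsOpen (vset u) := by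
    have : vset u = {K : NonemptyCompacts X | (K : Set X) ⊆ ⋃ V ∈ u, (V : Set X)} ∩
        ⋂ V ∈ u, {K : NonemptyCompacts X | ((K : Set X) ∩ V).Nonempty} := by
      ext K
      simp [vset, subset_def]
    rw [this]
    exact (NonemptyCompacts.isOpen_subsets_of_isOpen
      (isOpen_biUnion fun V _ => V.isOpen)).inter
        (hu.isOpen_biInter fun V _ => NonemptyCompacts.isOpen_inter_nonempty_of_isOpen V.isOpen)
  refine ⟨{W | ∃ u, (u.Finite ∧ u ⊆ P) ∧ vset u = W}, ?_, ?_⟩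
  · exact ((countable_ofPred_finite_subset hPc).image vset).preimage
      (SetLike.coe_injective (A := Opens (NonemptyCompacts X)))
  intro K hK U hU hKU
  obtain ⟨_, ⟨u, ⟨hu, -, huo⟩, rfl⟩, ⟨hKu, hKm⟩, huU⟩ :=
    NonemptyCompacts.isTopologicalBasis.exists_subset_of_mem_open hKU hU
  have hKA : (K : Set X) ⊆ ⋃ K ∈ A, (K : Set X) :=
    subset_biUnion_of_mem (u := fun K : NonemptyCompacts X => (K : Set X)) hK
  choose! O hOu hxO using fun x (hx : x ∈ (K : Set X)) => mem_sUnion.mp (hKu hx)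
  obtain ⟨c, hcP, hc, hKc, hcO⟩ := exists_finite_refining_cover hP K.isCompact hKA O
    fun x hx => ⟨huo _ (hOu x hx), hxO x hx⟩
  have key : ∀ W ∈ u, ∃ V ∈ P, ((K : Set X) ∩ V).Nonempty ∧ (V : Set X) ⊆ W := by
    intro W hW
    obtain ⟨x, hxK, hxW⟩ := hKm W hW
    obtain ⟨V, hV, hxV, hVW⟩ := hP x (hKA hxK) W (huo W hW) hxW
    exact ⟨V, hV, ⟨x, hxK, hxV⟩, hVW⟩
  choose! g hgP hgK hgW using key
  -- Members of `c` keep nearby compacta inside `⋃₀ u`; the sets `g W ⊆ W` force them to meet each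
  -- `W ∈ u`.
  have hfin : (c ∪ g '' u).Finite := hc.union (hu.image g)
  refine ⟨⟨vset (c ∪ g '' u), hvset _ hfin⟩,
    ⟨_, ⟨hfin, union_subset hcP (image_subset_iff.mpr hgP)⟩, rfl⟩, ⟨?_, ?_⟩, ?_⟩
  · intro x hx
    obtain ⟨V, hV, hxV⟩ := hKc x hx
    exact ⟨V, .inl hV, hxV⟩
  · rintro V (hV | ⟨W, hW, rfl⟩)
    · obtain ⟨x, hx, hxV, -⟩ := hcO V hV
      exact ⟨x, hx, hxV⟩
    · exact hgK W hW
  · rintro H ⟨hH₁, hH₂⟩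
    refine huU ⟨fun x hx => ?_, fun W hW => ?_⟩
    · obtain ⟨V, hV | ⟨W, hW, rfl⟩, hxV⟩ := hH₁ x hx
      · obtain ⟨y, hy, -, hVy⟩ := hcO V hV
        exact ⟨O y, hOu y hy, hVy hxV⟩
      · exact ⟨W, hW, hgW W hW hxV⟩
    · exact (hH₂ (g W) (.inr (mem_image_of_mem g hW))).mono (inter_subset_inter_right _ (hgW W hW))

/-! ### The Ponomarev space of neighborhood sequences -/

/-- The sequence `s` of open sets enumerates a neighborhood base at `x`. -/
def IsNhdsSeq (s : ℕ → Opens Y) (x : Y) : Prop :=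
  (∀ n, x ∈ s n) ∧ ∀ U : Set Y, IsOpen U → x ∈ U → ∃ n, (s n : Set Y) ⊆ U

theorem IsNhdsSeq.eq [T1Space Y] {s : ℕ → Opens Y} {x y : Y} (hx : IsNhdsSeq s x)
    (hy : IsNhdsSeq s y) : x = y := by
  by_contra hxy
  obtain ⟨n, hn⟩ := hx.2 {y}ᶜ isOpen_compl_singleton hxy
  exact hn (hy.1 n) rfl

theorem HasCountableOuterBase.exists_isNhdsSeq {K : Set Y} (h : HasCountableOuterBase K) {x : Y}
    (hx : x ∈ K) : ∃ s, IsNhdsSeq s x := by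
  obtain ⟨P, hPc, hP⟩ := h
  obtain ⟨V, hV, hxV, -⟩ := hP x hx univ isOpen_univ trivial
  obtain ⟨s, hs⟩ := (hPc.mono (sep_subset P (x ∈ ·))).exists_eq_range ⟨V, hV, hxV⟩
  refine ⟨s, fun n => ?_, fun U hU hxU => ?_⟩
  · exact (hs.ge (mem_range_self n)).2
  · obtain ⟨V, hV, hxV, hVU⟩ := hP x hx U hU hxU
    obtain ⟨n, rfl⟩ := hs.le ⟨hV, hxV⟩
    exact ⟨n, hVU⟩

/-- The space of sequences of open sets enumerating a neighborhood base at some point. -/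
abbrev NhdsSeq (Y : Type u) [TopologicalSpace Y] : Type u :=
  {s : ℕ → Opens Y // ∃ x, IsNhdsSeq s x}

/-- The point at which a sequence of open sets enumerates a neighborhood base. -/
noncomputable def NhdsSeq.limit (s : NhdsSeq Y) : Y := s.2.choose

theorem NhdsSeq.isNhdsSeq_limit (s : NhdsSeq Y) : IsNhdsSeq s.1 s.limit := s.2.choose_spec

theorem isClosed_setOf_mem_of_discrete {D : Type*} [TopologicalSpace D] [DiscreteTopology D]
    {F : D → Set Y} (hF : ∀ d, IsClosed (F d)) : IsClosed {p : Y × D | p.1 ∈ F p.2} := by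
  have : {p : Y × D | p.1 ∈ F p.2}ᶜ = ⋃ d, (F d)ᶜ ×ˢ {d} := by
    ext ⟨y, d⟩
    simp
  rw [← isOpen_compl_iff, this]
  exact isOpen_iUnion fun d => (hF d).isOpen_compl.prod (isOpen_discrete _)

section NhdsSeq

variable [TopologicalSpace (Opens Y)]

theorem NhdsSeq.continuous_limit [DiscreteTopology (Opens Y)] : Continuous (NhdsSeq.limit (Y := Y)) := by
  rw [continuous_iff_continuousAt]
  intro s T hT
  obtain ⟨U, hUT, hU, hsU⟩ := mem_nhds_iff.mp hT
  obtain ⟨n, hn⟩ := s.isNhdsSeq_limit.2 U hU hsU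
  have hc : Continuous fun t : NhdsSeq Y => t.1 n :=
    (continuous_apply n).comp continuous_subtype_val
  rw [mem_map]
  filter_upwards [((isOpen_discrete {s.1 n}).preimage hc).mem_nhds rfl] with t ht
  have : t.1 n = s.1 n := ht
  exact hUT (hn (this ▸ t.isNhdsSeq_limit.1 n))

theorem NhdsSeq.isOpenMap_limit [T1Space Y] (h : ∀ x : Y, ∃ s, IsNhdsSeq s x) :
    IsOpenMap (NhdsSeq.limit (Y := Y)) := by
  rw [isOpenMap_iff_nhds_le]
  intro s T hT
  rw [mem_map, nhds_subtype_eq_comap, mem_comap] at hT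
  obtain ⟨N, hN, hNT⟩ := hT
  rw [nhds_pi, Filter.mem_pi] at hN
  obtain ⟨I, hI, W, hW, hWN⟩ := hN
  obtain ⟨m, hm⟩ := hI.bddAbove
  have hO : IsOpen (⋂ i ∈ I, (s.1 i : Set Y)) := hI.isOpen_biInter fun i _ => (s.1 i).isOpen
  refine mem_of_superset (hO.mem_nhds (mem_iInter₂_of_mem fun i _ => s.isNhdsSeq_limit.1 i)) ?_
  intro y hy
  obtain ⟨e, he⟩ := h y
  classical
  -- Only the coordinates in `I` are constrained; the shift by `m + 1` places all of `e` beyond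
  -- them.
  let t : ℕ → Opens Y := fun i => if i ∈ I then s.1 i else e (i - (m + 1))
  have ht : IsNhdsSeq t y := by
    refine ⟨fun i => ?_, fun U hU hyU => ?_⟩
    · by_cases hi : i ∈ I
      · simpa [t, hi] using mem_iInter₂.mp hy i hi
      · simpa [t, hi] using he.1 _
    · obtain ⟨n, hn⟩ := he.2 U hU hyU
      have hnI : n + (m + 1) ∉ I := fun hmem => by
        have := hm hmem
        omega
      exact ⟨n + (m + 1), by simpa [t, hnI] using hn⟩
  have htT : NhdsSeq.limit (⟨t, y, ht⟩ : NhdsSeq Y) ∈ T := by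
    refine hNT (hWN fun i hi => ?_)
    simpa [t, hi] using mem_of_mem_nhds (hW i)
  rwa [← ht.eq (NhdsSeq.isNhdsSeq_limit ⟨t, y, ht⟩)] at htT

/-- Enumerate all finite covers of `K` from `P` and shrink each to a compact cover. Choosing, for
each cover, a member whose shrinking contains `x` yields a neighborhood sequence at `x`; the closed
conditions `x ∈ F n (s n)` make the set of choices compact. -/
theorem NhdsSeq.exists_isCompact_image_limit [DiscreteTopology (Opens Y)] [T2Space Y] {K : Set Y} (hK : IsCompact K)
    (h : HasCountableOuterBase K) :
    ∃ C : Set (NhdsSeq Y), IsCompact C ∧ NhdsSeq.limit '' C = K := by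
  obtain ⟨P, hPc, hP⟩ := h
  let covers : Set (Set (Opens Y)) := {c | (c.Finite ∧ c ⊆ P) ∧ ∀ x ∈ K, ∃ V ∈ c, x ∈ V}
  obtain ⟨c₀, hc₀P, hc₀, hKc₀, -⟩ := exists_finite_refining_cover hP hK subset_rfl
    (fun _ => univ) fun _ _ => ⟨isOpen_univ, trivial⟩
  obtain ⟨c, hc⟩ : ∃ c : ℕ → Set (Opens Y), covers = range c :=
    ((countable_ofPred_finite_subset hPc).mono (sep_subset _ _)).exists_eq_range
      ⟨c₀, ⟨hc₀, hc₀P⟩, hKc₀⟩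
  have hcmem (n : ℕ) : c n ∈ covers := hc.ge (mem_range_self n)
  have hshrink (n : ℕ) : ∃ F : Opens Y → Set Y, (∀ V, IsCompact (F V)) ∧ (∀ V, F V ⊆ V) ∧
      ∀ x ∈ K, ∃ V ∈ c n, x ∈ F V := by
    obtain ⟨F, hF, hFV, hKF⟩ := hK.finite_compact_cover (hcmem n).1.1.toFinset
      (fun V => (V : Set Y)) (fun V _ => V.isOpen) fun x hx => by
        simpa using (hcmem n).2 x hx
    exact ⟨F, hF, hFV, fun x hx => by simpa using hKF.le hx⟩
  choose F hFc hFV hKF using hshrink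
  have hseq {x : Y} (hx : x ∈ K) {s : ℕ → Opens Y} (hs : ∀ n, s n ∈ c n)
      (hxs : ∀ n, x ∈ F n (s n)) : IsNhdsSeq s x := by
    refine ⟨fun n => hFV n _ (hxs n), fun U hU hxU => ?_⟩
    obtain ⟨V, hV, hxV, hVU⟩ := hP x hx U hU hxU
    -- In the cover `insert V d` only `V` contains `x`, so the choice there must be `V`.
    obtain ⟨d, hdP, hd, hKd, hdx⟩ := exists_finite_refining_cover hP (hK.diff V.isOpen)
      sdiff_subset (fun _ => {x}ᶜ) fun y hy =>
        ⟨isOpen_compl_singleton, fun hyx => hy.2 (by rwa [mem_singleton_iff.mp hyx])⟩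
    obtain ⟨n, hn⟩ : insert V d ∈ range c := by
      rw [← hc]
      refine ⟨⟨hd.insert V, insert_subset hV hdP⟩, fun y hy => ?_⟩
      by_cases hyV : y ∈ V
      · exact ⟨V, mem_insert V d, hyV⟩
      · obtain ⟨W, hW, hyW⟩ := hKd y ⟨hy, hyV⟩
        exact ⟨W, .inr hW, hyW⟩
    refine ⟨n, ?_⟩
    obtain hsV | hsd := hn.le (hs n)
    · rwa [hsV]
    · obtain ⟨y, -, -, hyx⟩ := hdx _ hsd
      exact absurd rfl (hyx (hFV n _ (hxs n)))
  let R : Set (Y × (ℕ → Opens Y)) :=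
    (K ×ˢ univ.pi c) ∩ ⋂ n, {p | p.1 ∈ F n (p.2 n)}
  have hR : IsCompact R := by
    refine (hK.prod (isCompact_univ_pi fun n => (hcmem n).1.1.isCompact)).inter_right
      (isClosed_iInter fun n => ?_)
    exact (isClosed_setOf_mem_of_discrete fun V => (hFc n V).isClosed).preimage
      (f := fun p : Y × (ℕ → Opens Y) => (p.1, p.2 n)) (by fun_prop)
  have hRseq {p : Y × (ℕ → Opens Y)} (hp : p ∈ R) : IsNhdsSeq p.2 p.1 :=
    hseq hp.1.1 (fun n => hp.1.2 n trivial) fun n => mem_iInter.mp hp.2 n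
  refine ⟨Subtype.val ⁻¹' (Prod.snd '' R), ?_, ?_⟩
  · refine (IsInducing.subtypeVal.isCompact_preimage_iff ?_).mpr (hR.image continuous_snd)
    rintro _ ⟨p, hp, rfl⟩
    exact ⟨⟨p.2, p.1, hRseq hp⟩, rfl⟩
  · ext x
    constructor
    · rintro ⟨s, ⟨p, hp, hps⟩, rfl⟩
      have := (hRseq hp).eq (hps ▸ s.isNhdsSeq_limit)
      exact this ▸ hp.1.1
    · intro hx
      choose s hs hxs using fun n => hKF n x hx
      have hxR : (x, s) ∈ R := ⟨⟨hx, fun n _ => hs n⟩, mem_iInter.mpr hxs⟩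
      exact ⟨⟨s, x, hRseq hxR⟩, ⟨_, hxR, rfl⟩, (NhdsSeq.isNhdsSeq_limit _).eq (hRseq hxR)⟩

end NhdsSeq

theorem isOpenCompactCoveringImageOfMetric_of_hasCountableOuterBase [T2Space Y]
    (h : ∀ K : Set Y, IsCompact K → HasCountableOuterBase K) :
    IsOpenCompactCoveringImageOfMetric Y := by
  let : TopologicalSpace (Opens Y) := ⊥
  have : DiscreteTopology (Opens Y) := ⟨rfl⟩
  have : MetrizableSpace (ℕ → Opens Y) :=
    let := PiNat.metricSpace (E := fun _ => Opens Y)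
    inferInstance
  have : MetrizableSpace (NhdsSeq Y) := IsEmbedding.subtypeVal.metrizableSpace
  have hseq (x : Y) : ∃ s, IsNhdsSeq s x := (h {x} isCompact_singleton).exists_isNhdsSeq rfl
  refine ⟨NhdsSeq Y, metrizableSpaceMetric (NhdsSeq Y), NhdsSeq.limit,
    ⟨NhdsSeq.continuous_limit, fun K hK => NhdsSeq.exists_isCompact_image_limit hK (h K hK)⟩,
    NhdsSeq.isOpenMap_limit hseq, fun x => ?_⟩
  obtain ⟨s, hs⟩ := hseq x
  exact ⟨⟨s, x, hs⟩, (NhdsSeq.isNhdsSeq_limit _).eq hs⟩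

theorem encard_pair_sup_le (x y : X) :
    (({x} ⊔ {y} : HyperK X) : Set X).encard ≤ (2 : ℕ) := by
  rw [NonemptyCompacts.coe_sup, NonemptyCompacts.coe_singleton, NonemptyCompacts.coe_singleton,
    singleton_union]
  exact (encard_insert_le {y} x).trans (by rw [encard_singleton]; norm_num)

/-- The map `(x, y) ↦ {x, y}`. -/
def pair (p : X × X) : HyperFn 2 X := ⟨{p.1} ⊔ {p.2}, encard_pair_sup_le p.1 p.2⟩

theorem continuous_pair : Continuous (pair (X := X)) :=
  Continuous.subtype_mk ((NonemptyCompacts.continuous_singleton.comp continuous_fst).sup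
    (NonemptyCompacts.continuous_singleton.comp continuous_snd)) _

theorem eq_of_pair_eq_pair_self {x y z : X} (h : pair (x, y) = pair (z, z)) : x = y := by
  have h' := congrArg (fun A : HyperFn 2 X => (A.1 : Set X)) h
  simp only [pair, NonemptyCompacts.coe_sup, NonemptyCompacts.coe_singleton, union_self] at h'
  have hx : x ∈ ({z} : Set X) := h' ▸ .inl rfl
  have hy : y ∈ ({z} : Set X) := h' ▸ .inr rfl
  exact hx.trans hy.symm

theorem isInducing_pair_diag : IsInducing fun x : X => pair (x, x) := by
  refine .of_comp (continuous_pair.comp (by fun_prop)) continuous_subtype_val ?_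
  have : (fun x : X => (pair (x, x)).1) = ({·} : X → NonemptyCompacts X) :=
    funext fun x => sup_idem _
  exact (congrArg IsInducing this).mpr NonemptyCompacts.isEmbedding_singleton.isInducing

theorem IsD0Space.metrizableSpace_of_isCompact [T2Space X] (h : IsD0Space (HyperFn 2 X))
    {K : Set X} (hK : IsCompact K) : MetrizableSpace K := by
  have : CompactSpace K := isCompact_iff_compactSpace.mp hK
  let : UniformSpace K := uniformSpaceOfCompactR1
  let p : K × K → HyperFn 2 X := fun q => pair (q.1, q.2)
  have hp : Continuous p := continuous_pair.comp (by fun_prop)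
  have hdiag : IsCompact (p '' diagonal K) := isClosed_diagonal.isCompact.image hp
  obtain ⟨B, hBc, hB, hBU⟩ := h _ hdiag
  have hbasis : (uniformity K).HasBasis (· ∈ B) (p ⁻¹' ·) := by
    rw [← nhdsSet_diagonal_eq_uniformity]
    refine ⟨fun T => ?_⟩
    rw [mem_nhdsSet_iff_exists]
    constructor
    · rintro ⟨U, hU, hdU, hUT⟩
      -- The image of `Uᶜ` is compact, hence closed, and contains no singleton.
      obtain ⟨V, hV, hVU⟩ := hBU (p '' Uᶜ)ᶜ
        (hU.isClosed_compl.isCompact.image hp).isClosed.isOpen_compl <| by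
        rintro _ ⟨⟨x, y⟩, hxy, rfl⟩ ⟨⟨a, b⟩, hab, habxy⟩
        obtain rfl : x = y := hxy
        obtain rfl : a = b := Subtype.ext (eq_of_pair_eq_pair_self habxy)
        exact hab (hdU rfl)
      refine ⟨V, hV, fun q hq => hUT ?_⟩
      by_contra hqU
      exact hVU hq (mem_image_of_mem p hqU)
    · rintro ⟨V, hV, hVT⟩
      exact ⟨p ⁻¹' V, (hB V hV).1.preimage hp, image_subset_iff.mp (hB V hV).2, hVT⟩
  have : (uniformity K).IsCountablyGenerated :=
    HasCountableBasis.isCountablyGenerated ⟨hbasis, hBc⟩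
  exact UniformSpace.metrizableSpace

end Hyperspace

theorem mainTheorem3 (X : Type u) [TopologicalSpace X] [T1Space X] [RegularSpace X] :
    List.TFAE [
      Hyperspace.IsOpenCompactCoveringImageOfMetric (Hyperspace.HyperK X),
      Hyperspace.IsD0Space (Hyperspace.HyperK X),
      Hyperspace.IsD0Space (Hyperspace.HyperF X),
      Hyperspace.IsD0Space (Hyperspace.HyperFn 2 X),
      Hyperspace.IsD0Space X ∧ ∀ K : Set X, IsCompact K → MetrizableSpace K] := by
  tfae_have 1 → 2 := fun h => h.isD0Space
  tfae_have 2 → 3 := fun h => h.of_isInducing IsInducing.subtypeVal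
  tfae_have 3 → 4 := fun h => by
    let ι : Hyperspace.HyperFn 2 X → Hyperspace.HyperF X :=
      fun A => ⟨A.1, finite_of_encard_le_coe A.2⟩
    have hι : Continuous ι := continuous_subtype_val.subtype_mk _
    exact h.of_isInducing (.of_comp hι continuous_subtype_val IsInducing.subtypeVal)
  tfae_have 4 → 5 := fun h =>
    ⟨h.of_isInducing Hyperspace.isInducing_pair_diag, fun K hK => h.metrizableSpace_of_isCompact hK⟩
  tfae_have 5 → 1 := fun ⟨h, hm⟩ =>
    Hyperspace.isOpenCompactCoveringImageOfMetric_of_hasCountableOuterBase fun A hA => by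
      have hU := NonemptyCompacts.isCompact_biUnion_coe_of_isCompact hA
      have := hm _ hU
      exact (h.hasCountableOuterBase hU).nonemptyCompacts
  tfae_finish
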